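/- Let $\mathcal X$ be a compact metric space with its Borel $\sigma$-algebra, and let $G,H$ be Borel probability measures on $\mathcal X$. Let $\kappa^*\in[0,1)$, $F=(1-\kappa^*)G+\kappa^*H$ and $\lambda^*=\frac1{1-\kappa^*}$. Let $\mathcal H$ be a reproducing kernel Hilbert space of real functions on $\mathcal X$ with Borel measurable kernel $k$, $k(x,x)\le 1$ for all $x\in\mathcal X$, and write $\phi(x)=k(x,\cdot)\in\mathcal H$. Let $\alpha>0$ and $\beta\in\mathbb R$, and suppose that $k,G,H$ satisfy the separability condition with margin $\alpha$ and tolerance $\beta$: there is $h\in\mathcal H$ with $\|h\|_{\mathcal H}\le1$ and $$\mathbf E_{X\sim G}h(X)\ \le\ \inf_{x\in\mathcal X}h(x)+\beta\ \le\ \mathbf E_{X\sim H}h(X)-\alpha .$$ Let $x_1,\dots,x_n$ be drawn i.i.d. from $F$ and $x_{n+1},\dots,x_{n+m}$ be drawn i.i.d. from $H$. Put $\phi(\hat F)=\frac1n\sum_{i=1}^n\phi(x_i)$, $\phi(\hat H)=\frac1m\sum_{i=n+1}^{n+m}\phi(x_i)$ and $\mathcal C_S=\{\sum_{i=1}^{n+m}a_i\phi(x_i):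 a_i\ge0,\ \sum_i a_i=1\}$. For $\lambda,\tau\ge0$ define $$\hat d(\lambda)=\inf_{w\in\mathcal C_S}\|\lambda\phi(\hat F)+(1-\lambda)\phi(\hat H)-w\|_{\mathcal H},\qquad \hat\lambda^V_\tau=\inf\{\lambda\ge0:\hat d(\lambda)\ge\tau\}.$$ Let $\delta\in(0,\frac14]$, suppose that $\min(m,n)>\frac{(12\lambda^*)^2\log(1/\delta)}{\alpha^2}$, and let $\tau$ satisfy $$\frac{3\lambda^*\sqrt{\log(1/\delta)}\,\bigl(2-1/\lambda^*+\sqrt{2/\lambda^*}\bigr)}{\sqrt{\min(m,n)}}\ \le\ \tau\ \le\ \frac{6\lambda^*\sqrt{\log(1/\delta)}\,\bigl(2-1/\lambda^*+\sqrt{2/\lambda^*}\bigr)}{\sqrt{\min(m,n)}} .$$ Then, with probability at least $1-4\delta$, both $$\lambda^*-\hat\lambda^V_\tau\le 0\qquad\text{and}\qquad \hat\lambda^V_\tau-\lambda^*\le\frac{\beta\lambda^*}{\alpha}+c\,\sqrt{\log(1/\delta)}\,(\min(m,n))^{-1/2},$$ where $$c=\frac{6\alpha(\lambda^*)^2\bigl(2-1/\lambda^*+\sqrt{2/\lambda^*}\bigr)+2\lambda^*\bigl(3\alpha+6\lambda^*(2+\alpha+\beta)\bigr)}{\alpha^2}.$$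 -/

import Mathlib

open MeasureTheory ProbabilityTheory

namespace MixtureProportion

noncomputable section

/-- The real-valued reproducing kernel `k(x, y)` of a reproducing kernel Hilbert space `𝓗` of
real functions on `𝒳`. -/
def realKernel {𝒳 : Type*} (𝓗 : Type*) [NormedAddCommGroup 𝓗] [InnerProductSpace ℝ 𝓗]
    [CompleteSpace 𝓗] [RKHS ℝ 𝓗 𝒳 ℝ] (x y : 𝒳) : ℝ :=
  RKHS.kernel 𝓗 x y 1

/-- The feature map `φ(x) = k(x, ·)`, an element of the Hilbert space. -/
def featureMap {𝒳 : Type*} (𝓗 : Type*) [NormedAddCommGroup 𝓗] [InnerProductSpace ℝ 𝓗]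
    [CompleteSpace 𝓗] [RKHS ℝ 𝓗 𝒳 ℝ] (x : 𝒳) : 𝓗 :=
  RKHS.kerFun 𝓗 x 1

/-- The embedding `φ(P̂)` of the uniform distribution `P̂` on a finite sample. -/
def empiricalMean {𝒳 : Type*} (𝓗 : Type*) [NormedAddCommGroup 𝓗] [InnerProductSpace ℝ 𝓗]
    [CompleteSpace 𝓗] [RKHS ℝ 𝓗 𝒳 ℝ] {n : ℕ} (x : Fin n → 𝒳) : 𝓗 :=
  (n : ℝ)⁻¹ • ∑ i, featureMap 𝓗 (x i)

/-- The set `𝒞_S` of all mixtures `∑ aᵢ φ(xᵢ)` of the embedded points of both samples, with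
weights `a` in the probability simplex. -/
def sampleHull {𝒳 : Type*} (𝓗 : Type*) [NormedAddCommGroup 𝓗] [InnerProductSpace ℝ 𝓗]
    [CompleteSpace 𝓗] [RKHS ℝ 𝓗 𝒳 ℝ] {n m : ℕ} (x : Fin n → 𝒳) (y : Fin m → 𝒳) : Set 𝓗 :=
  {w | ∃ a ∈ stdSimplex ℝ (Fin n ⊕ Fin m),
    w = ∑ i, a i • featureMap 𝓗 (Sum.elim x y i)}

/-- The empirical distance function
`d̂(l) = inf_{w ∈ 𝒞_S} ‖l φ(F̂) + (1 - l) φ(Ĥ) - w‖`, where `F̂` and `Ĥ` are the uniform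
distributions on the samples `x` and `y`. -/
def empiricalDist {𝒳 : Type*} (𝓗 : Type*) [NormedAddCommGroup 𝓗] [InnerProductSpace ℝ 𝓗]
    [CompleteSpace 𝓗] [RKHS ℝ 𝓗 𝒳 ℝ] {n m : ℕ} (x : Fin n → 𝒳) (y : Fin m → 𝒳) (l : ℝ) : ℝ :=
  ⨅ w : sampleHull 𝓗 x y,
    ‖l • empiricalMean 𝓗 x + (1 - l) • empiricalMean 𝓗 y - (w : 𝓗)‖

/-- The value thresholding estimator `inf {l ≥ 0 : d̂(l) ≥ τ}`. (Were the set empty, this real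
infimum would be `0`.) -/
def valueThresholdEstimator {𝒳 : Type*} (𝓗 : Type*) [NormedAddCommGroup 𝓗]
    [InnerProductSpace ℝ 𝓗] [CompleteSpace 𝓗] [RKHS ℝ 𝓗 𝒳 ℝ] {n m : ℕ}
    (x : Fin n → 𝒳) (y : Fin m → 𝒳) (τ : ℝ) : ℝ :=
  sInf {l : ℝ | 0 ≤ l ∧ τ ≤ empiricalDist 𝓗 x y l}

/-- Separability of the distributions `G`, `H` by the unit ball of the reproducing kernel Hilbert
space `𝓗`, with margin `α > 0` and tolerance `β`: some `h` in the ball has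
`E_G h ≤ inf h + β ≤ E_H h - α`. -/
def Separable {𝒳 : Type*} [MeasurableSpace 𝒳] (𝓗 : Type*) [NormedAddCommGroup 𝓗]
    [InnerProductSpace ℝ 𝓗] [RKHS ℝ 𝓗 𝒳 ℝ] (G H : Measure 𝒳) (α β : ℝ) : Prop :=
  0 < α ∧ ∃ h : 𝓗, ‖h‖ ≤ 1 ∧
    ∫ x, h x ∂G ≤ (⨅ x, h x) + β ∧ (⨅ x, h x) + β ≤ ∫ x, h x ∂H - α

end

end MixtureProportion

/-! Write `Λ` for `λ*`. Since `F = (1-κ)G + κH`, the extrapolation `ΛF + (1-Λ)H` equals `G`, and `G`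
has a density `g` with respect to `F` with `0 ≤ g ≤ Λ`. Reweighting the first sample by `g` and
normalising gives a point of the hull near the extrapolation at `Λ`, so `d̂(Λ) ≤ τ`
(`exists_mem_sampleHull_norm_sub_le`). A contraction argument makes the inequality strict on `[0,
Λ)` (`empiricalDist_lt`), so the estimator is not below `Λ`.

For the upper bound, test against the separating `h`: its pairing with any hull point is at least
`inf h`, while separability bounds its pairing with the population extrapolation at `l ≥ Λ` by `inf
h + β - (l/Λ - 1)α`. Hence `d̂(l)` grows at least linearly (`le_empiricalDist`) and reaches `τ` by
an explicit `l` (`exists_threshold_crossing`).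

The randomness enters through four empirical means, each off by `δ` in probability: those of `φ`
under `F` and `H`, of `(Λ - g)φ`, and of `g`. Each is controlled by McDiarmid's inequality for the
norm of the deviation, whose expectation is bounded through its second moment. Means are weak
integrals, so no separability of the Hilbert space is needed. -/

/-! ### Bounded differences -/

/-- **McDiarmid's inequality**, moment generating function form: a bounded function of `n`
independent variables of law `Q` whose value moves by at most `c` when one variable is changed
is sub-Gaussian with parameter `n (c / 2) ^ 2`. -/
theorem integral_exp_le_of_bounded_differences {𝒳 : Type*} [MeasurableSpace 𝒳] (Q : Measure 𝒳)
    [IsProbabilityMeasure Q] (c t : ℝ) (n : ℕ) (f : (Fin n → 𝒳) → ℝ) (hf : Measurable f)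
    (C : ℝ) (hC : ∀ x, |f x| ≤ C)
    (hc : ∀ x i y, |f (Function.update x i y) - f x| ≤ c) :
    ∫ x, Real.exp (t * f x) ∂Measure.pi (fun _ : Fin n => Q)
      ≤ Real.exp (t * ∫ x, f x ∂Measure.pi (fun _ : Fin n => Q) + n * (c / 2) ^ 2 * t ^ 2 / 2) := by
  induction n with
  | zero =>
    have h : ∀ x, f x = f Fin.elim0 := fun x => by
      rw [Subsingleton.elim x Fin.elim0]
    simp [h]
  | succ n ih =>
    have bnd : ∀ {Y : Type _} [MeasurableSpace Y] (ν : Measure Y) [IsProbabilityMeasure ν]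
        (g : Y → ℝ), Measurable g → (∀ y, |g y| ≤ C) → Integrable g ν := fun ν _ g hg hgC =>
      Integrable.of_bound hg.aestronglyMeasurable C (Filter.Eventually.of_forall hgC)
    have bndexp : ∀ {Y : Type _} [MeasurableSpace Y] (ν : Measure Y) [IsProbabilityMeasure ν]
        (g : Y → ℝ), Measurable g → (∀ y, |g y| ≤ C) →
        Integrable (fun y => Real.exp (t * g y)) ν := fun ν _ g hg hgC =>
      integrable_exp_mul_of_mem_Icc (a := -C) (b := C) hg.aemeasurable
        (Filter.Eventually.of_forall fun y => abs_le.1 (hgC y))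
    set ν := Measure.pi (fun _ : Fin n => Q) with hν
    have mp := (measurePreserving_piFinSuccAbove (fun _ : Fin (n + 1) => Q) 0).symm
    have hcoe : ∀ z, (MeasurableEquiv.piFinSuccAbove (fun _ : Fin (n + 1) => 𝒳) 0).symm z
        = Fin.cons z.1 z.2 := fun z => Fin.insertNth_zero' z.1 z.2
    have key : ∀ φ : (Fin (n + 1) → 𝒳) → ℝ,
        ∫ x, φ x ∂Measure.pi (fun _ : Fin (n + 1) => Q)
          = ∫ z : 𝒳 × (Fin n → 𝒳), φ (Fin.cons z.1 z.2) ∂(Q.prod ν) := fun φ => by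
      simp_rw [← hcoe]
      exact (mp.integral_comp' φ).symm
    have hcons : Measurable fun z : 𝒳 × (Fin n → 𝒳) => (Fin.cons z.1 z.2 : Fin (n + 1) → 𝒳) := by
      simp_rw [← hcoe]
      exact mp.measurable
    have hfc : Measurable fun z : 𝒳 × (Fin n → 𝒳) => f (Fin.cons z.1 z.2) := hf.comp hcons
    have hfa : ∀ a, Measurable fun y : Fin n → 𝒳 => f (Fin.cons a y) := fun a =>
      hfc.comp measurable_prodMk_left
    -- Integrating out all but the first variable leaves `g`, which oscillates by at most `c`.
    -- Hoeffding's lemma handles `g`, the induction hypothesis the remaining variables.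
    set g : 𝒳 → ℝ := fun a => ∫ y, f (Fin.cons a y) ∂ν with hg
    have hgm : Measurable g :=
      (hfc.stronglyMeasurable.integral_prod_right (ν := ν)).measurable
    have hgb : ∀ a b, g b - g a ≤ c := fun a b => by
      rw [hg]
      simp only
      rw [← integral_sub (bnd _ _ (hfa b) fun _ => hC _) (bnd _ _ (hfa a) fun _ => hC _)]
      calc _ ≤ ∫ y : Fin n → 𝒳, c ∂ν := by
            refine integral_mono ((bnd _ _ (hfa b) fun _ => hC _).sub
              (bnd _ _ (hfa a) fun _ => hC _)) (integrable_const _) fun y => ?_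
            have := hc (Fin.cons a y) 0 b
            rw [Fin.update_cons_zero] at this
            exact (abs_le.1 this).2
        _ = c := by simp
    have hgC : ∀ a, |g a| ≤ C := fun a => by
      have := norm_integral_le_of_norm_le_const (μ := ν) (f := fun y => f (Fin.cons a y)) (C := C)
        (Filter.Eventually.of_forall fun y => hC _)
      simpa using this
    obtain ⟨a₀⟩ : Nonempty 𝒳 := nonempty_of_isProbabilityMeasure Q
    have hc0 : 0 ≤ c := by simpa using hgb a₀ a₀
    have hbdd : BddBelow (Set.range g) := ⟨-C, by rintro _ ⟨a, rfl⟩; exact (abs_le.1 (hgC a)).1⟩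
    have hoeff := (hasSubgaussianMGF_of_mem_Icc (μ := Q) (X := g) (a := ⨅ a, g a)
      (b := (⨅ a, g a) + c) hgm.aemeasurable (Filter.Eventually.of_forall fun a =>
        ⟨ciInf_le hbdd a, by
          have : Nonempty 𝒳 := ⟨a⟩
          have : g a - c ≤ ⨅ b, g b := le_ciInf fun b => by linarith [hgb b a]
          linarith⟩)).mgf_le t
    rw [key, key, integral_prod _ (bndexp _ _ hfc fun _ => hC _),
      integral_prod _ (bnd _ _ hfc fun _ => hC _)]
    have hin : ∀ a, ∫ y, Real.exp (t * f (Fin.cons a y)) ∂ν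
        ≤ Real.exp (t * g a + n * (c / 2) ^ 2 * t ^ 2 / 2) := fun a =>
      ih (fun y => f (Fin.cons a y)) (hfa a) (fun _ => hC _) fun y i b => by
        rw [Fin.cons_update]; exact hc _ _ _
    calc ∫ a, ∫ y, Real.exp (t * f (Fin.cons a y)) ∂ν ∂Q
        ≤ ∫ a, Real.exp (t * g a) * Real.exp (n * (c / 2) ^ 2 * t ^ 2 / 2) ∂Q := by
          refine integral_mono_of_nonneg (Filter.Eventually.of_forall fun a =>
            integral_nonneg fun y => (Real.exp_pos _).le) ((bndexp _ _ hgm hgC).mul_const _)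
            (Filter.Eventually.of_forall fun a => ?_)
          simpa only [Real.exp_add] using hin a
      _ = mgf (fun a => g a - ∫ b, g b ∂Q) Q t
            * Real.exp (t * (∫ b, g b ∂Q) + n * (c / 2) ^ 2 * t ^ 2 / 2) := by
          rw [mgf, ← integral_mul_const]
          simp only [← Real.exp_add]
          refine congrArg (fun φ => ∫ a, φ a ∂Q) (funext fun a => congrArg Real.exp ?_)
          ring
      _ ≤ Real.exp ((c / 2) ^ 2 * t ^ 2 / 2)
            * Real.exp (t * (∫ b, g b ∂Q) + n * (c / 2) ^ 2 * t ^ 2 / 2) := by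
          gcongr
          refine hoeff.trans (le_of_eq ?_)
          simp [abs_of_nonneg hc0, div_pow]
      _ = _ := by
          rw [← Real.exp_add]
          push_cast
          congr 1
          ring

/-- **McDiarmid's inequality**, tail form. -/
theorem measure_pi_ge_le_of_bounded_differences {𝒳 : Type*} [MeasurableSpace 𝒳] (Q : Measure 𝒳)
    [IsProbabilityMeasure Q] (c : ℝ) (n : ℕ) (f : (Fin n → 𝒳) → ℝ)
    (hf : Measurable f) (C : ℝ) (hC : ∀ x, |f x| ≤ C)
    (hc : ∀ x i y, |f (Function.update x i y) - f x| ≤ c) (s : ℝ) (hs : 0 ≤ s) :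
    (Measure.pi (fun _ : Fin n => Q)).real
        {x | s ≤ f x - ∫ z, f z ∂Measure.pi (fun _ : Fin n => Q)}
      ≤ Real.exp (-s ^ 2 / (2 * (n * (c / 2) ^ 2))) := by
  set ν := Measure.pi (fun _ : Fin n => Q)
  have hsub : HasSubgaussianMGF (fun x => f x - ∫ z, f z ∂ν)
      (⟨n * (c / 2) ^ 2, by positivity⟩ : NNReal) ν := by
    refine ⟨fun t => ?_, fun t => ?_⟩
    · refine integrable_exp_mul_of_mem_Icc (a := -C - ∫ z, f z ∂ν) (b := C - ∫ z, f z ∂ν)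
        (hf.sub_const _).aemeasurable (Filter.Eventually.of_forall fun y => ?_)
      have := abs_le.1 (hC y)
      constructor <;> linarith
    · have := integral_exp_le_of_bounded_differences Q c t n f hf C hC hc
      rw [mgf]
      simp only [mul_sub, Real.exp_sub, integral_div]
      rw [div_le_iff₀ (Real.exp_pos _), ← Real.exp_add, add_comm]
      exact this
  exact hsub.measure_ge_le hs

/-! ### Empirical means in an inner product space -/

section Concentration

variable {𝒳 : Type*} [MeasurableSpace 𝒳] {E : Type*} [NormedAddCommGroup E]
  [InnerProductSpace ℝ E]

/-- The distance of an empirical mean from a fixed vector is measurable as soon as the inner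
products are; `Z` itself need not be measurable. -/
theorem measurable_norm_empirical_sub {Z : 𝒳 → E} {μ : E}
    (hZ : ∀ v, Measurable fun x => inner ℝ v (Z x))
    (hZZ : Measurable fun p : 𝒳 × 𝒳 => inner ℝ (Z p.1) (Z p.2)) (n : ℕ) :
    Measurable fun x : Fin n → 𝒳 => ‖(n : ℝ)⁻¹ • ∑ i, Z (x i) - μ‖ := by
  have h : (fun x : Fin n → 𝒳 => ‖(n : ℝ)⁻¹ • ∑ i, Z (x i) - μ‖) = fun x : Fin n → 𝒳 =>
      √((n : ℝ)⁻¹ * ((n : ℝ)⁻¹ * ∑ i, ∑ j, inner ℝ (Z (x i)) (Z (x j)))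
        - 2 * ((n : ℝ)⁻¹ * ∑ i, inner ℝ μ (Z (x i))) + ‖μ‖ ^ 2) := by
    ext x
    rw [← Real.sqrt_sq (norm_nonneg ((n : ℝ)⁻¹ • ∑ i, Z (x i) - μ)), norm_sub_sq_real,
      ← real_inner_self_eq_norm_sq, real_inner_smul_left, real_inner_smul_right,
      real_inner_comm, real_inner_smul_left]
    simp only [inner_sum, sum_inner]
    rw [Finset.sum_comm]
    simp only [fun x => real_inner_comm μ (Z x)]
  rw [h]
  refine ((((Finset.measurable_sum _ fun i _ => Finset.measurable_sum _ fun j _ => ?_).const_mul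
    _).const_mul _).sub (((Finset.measurable_sum _ fun i _ => ?_).const_mul _).const_mul _)
    |>.add_const _).sqrt
  · exact hZZ.comp (g := fun p : 𝒳 × 𝒳 => inner ℝ (Z p.1) (Z p.2))
      (f := fun x : Fin n → 𝒳 => (x i, x j))
      ((measurable_pi_apply i).prodMk (measurable_pi_apply j))
  · exact (hZ μ).comp (measurable_pi_apply i)

/-- The mean square error of the empirical mean of `n` independent copies of a vector of norm at
most `A` is at most `A ^ 2 / n`. -/
theorem integral_norm_sq_empirical_sub_le (Q : Measure 𝒳) [IsProbabilityMeasure Q] {Z : 𝒳 → E}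
    {μ : E} {A : ℝ} (hA : ∀ x, ‖Z x‖ ≤ A) (hZ : ∀ v, Measurable fun x => inner ℝ v (Z x))
    (hZZ : Measurable fun p : 𝒳 × 𝒳 => inner ℝ (Z p.1) (Z p.2))
    (hμ : ∀ v, ∫ x, inner ℝ v (Z x) ∂Q = inner ℝ v μ) {n : ℕ} (hn : 0 < n) :
    ∫ x : Fin n → 𝒳, ‖(n : ℝ)⁻¹ • ∑ i, Z (x i) - μ‖ ^ 2 ∂Measure.pi (fun _ => Q)
      ≤ A ^ 2 / n := by
  have hn' : (n : ℝ) ≠ 0 := by positivity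
  obtain ⟨x₀⟩ : Nonempty 𝒳 := nonempty_of_isProbabilityMeasure Q
  have hA0 : 0 ≤ A := (norm_nonneg _).trans (hA x₀)
  set ν := Measure.pi (fun _ : Fin n => Q)
  -- The mean square error is a double average of this centred kernel: the off-diagonal terms vanish
  -- by independence, so only `n` of the `n ^ 2` terms survive.
  set K : 𝒳 → 𝒳 → ℝ := fun x y => inner ℝ (Z x - μ) (Z y - μ) with hK
  have hKm : Measurable fun p : 𝒳 × 𝒳 => K p.1 p.2 := by
    simp only [hK, inner_sub_left, inner_sub_right]
    simp only [fun x => real_inner_comm μ (Z x)]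
    exact (hZZ.sub ((hZ μ).comp measurable_snd)).sub
      (((hZ μ).comp measurable_fst).sub measurable_const)
  have hKb : ∀ x y, ‖K x y‖ ≤ (A + ‖μ‖) * (A + ‖μ‖) := fun x y =>
    (norm_inner_le_norm _ _).trans (by
      gcongr <;> exact (norm_sub_le _ _).trans (by gcongr; exact hA _))
  have hKi : ∀ i j : Fin n, Integrable (fun x : Fin n → 𝒳 => K (x i) (x j)) ν := fun i j =>
    Integrable.of_bound (hKm.comp (g := fun p : 𝒳 × 𝒳 => K p.1 p.2)
      (f := fun x : Fin n → 𝒳 => (x i, x j)) ((measurable_pi_apply i).prodMk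
      (measurable_pi_apply j))).aestronglyMeasurable _
      (Filter.Eventually.of_forall fun x => hKb _ _)
  have hZi : ∀ v, Integrable (fun x => inner ℝ v (Z x)) Q := fun v =>
    Integrable.of_bound (hZ v).aestronglyMeasurable (‖v‖ * A)
      (Filter.Eventually.of_forall fun x => (norm_inner_le_norm _ _).trans (by gcongr; exact hA _))
  have hdiag : ∀ i : Fin n, ∫ x : Fin n → 𝒳, K (x i) (x i) ∂ν ≤ A ^ 2 := fun i => by
    have mp := measurePreserving_eval (fun _ : Fin n => Q) i
    have hKd : Measurable fun y => K y y := hKm.comp (measurable_id.prodMk measurable_id)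
    have h1 : ∫ x : Fin n → 𝒳, K (x i) (x i) ∂ν = ∫ y, K y y ∂Q := by
      rw [← mp.map_eq, integral_map mp.measurable.aemeasurable hKd.aestronglyMeasurable]
    rw [h1]
    calc ∫ y, K y y ∂Q ≤ ∫ y, (A ^ 2 + ‖μ‖ ^ 2 - 2 * inner ℝ μ (Z y)) ∂Q := by
          refine integral_mono (Integrable.of_bound hKd.aestronglyMeasurable _
            (Filter.Eventually.of_forall fun x => hKb _ _))
            ((integrable_const _).sub ((hZi μ).const_mul 2)) fun y => ?_
          simp only [hK, real_inner_self_eq_norm_sq, norm_sub_sq_real, real_inner_comm μ]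
          have := pow_le_pow_left₀ (norm_nonneg _) (hA y) 2
          linarith [real_inner_comm μ (Z y)]
      _ = A ^ 2 - ‖μ‖ ^ 2 := by
          rw [integral_sub (integrable_const _) ((hZi μ).const_mul 2), integral_const_mul, hμ,
            real_inner_self_eq_norm_sq]
          simp
          ring
      _ ≤ A ^ 2 := by linarith [sq_nonneg ‖μ‖]
  have hoff : ∀ i j : Fin n, i ≠ j → ∫ x : Fin n → 𝒳, K (x i) (x j) ∂ν = 0 := fun i j hij => by
    have hind := (iIndepFun_pi (μ := fun _ : Fin n => Q) (X := fun _ x => x)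
      (fun _ => aemeasurable_id)).indepFun hij
    rw [indepFun_iff_map_prod_eq_prod_map_map (measurable_pi_apply i).aemeasurable
      (measurable_pi_apply j).aemeasurable,
      (measurePreserving_eval (fun _ : Fin n => Q) i).map_eq,
      (measurePreserving_eval (fun _ : Fin n => Q) j).map_eq] at hind
    have h1 : ∫ x : Fin n → 𝒳, K (x i) (x j) ∂ν = ∫ p : 𝒳 × 𝒳, K p.1 p.2 ∂(Q.prod Q) := by
      rw [← hind, integral_map ((measurable_pi_apply i).prodMk
        (measurable_pi_apply j)).aemeasurable hKm.aestronglyMeasurable]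
    rw [h1, integral_prod _ (Integrable.of_bound hKm.aestronglyMeasurable _
      (Filter.Eventually.of_forall fun p => hKb _ _))]
    refine (integral_congr_ae (Filter.Eventually.of_forall fun x => ?_)).trans
      (integral_zero 𝒳 ℝ)
    simp only [hK, inner_sub_right (Z x - μ)]
    rw [integral_sub (hZi _) (integrable_const _), hμ]
    simp
  have hexp : ∀ x : Fin n → 𝒳, ‖(n : ℝ)⁻¹ • ∑ i, Z (x i) - μ‖ ^ 2
      = (n : ℝ)⁻¹ * ((n : ℝ)⁻¹ * ∑ i, ∑ j, K (x i) (x j)) := fun x => by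
    have : (n : ℝ)⁻¹ • ∑ i, Z (x i) - μ = (n : ℝ)⁻¹ • ∑ i, (Z (x i) - μ) := by
      rw [Finset.sum_sub_distrib, smul_sub]
      simp [← Nat.cast_smul_eq_nsmul ℝ, smul_smul, hn']
    rw [this, ← real_inner_self_eq_norm_sq, real_inner_smul_left, real_inner_smul_right,
      sum_inner]
    simp only [inner_sum, hK]
  simp only [hexp]
  rw [integral_const_mul, integral_const_mul, integral_finsetSum _ fun i _ =>
    integrable_finsetSum _ fun j _ => hKi i j]
  have : ∑ i : Fin n, ∫ x : Fin n → 𝒳, ∑ j, K (x i) (x j) ∂ν ≤ n * A ^ 2 := by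
    calc _ ≤ ∑ _i : Fin n, A ^ 2 := Finset.sum_le_sum fun i _ => by
          rw [integral_finsetSum _ fun j _ => hKi i j, Finset.sum_eq_single i
            (fun j _ hj => hoff i j hj.symm) (by simp)]
          exact hdiag i
      _ = n * A ^ 2 := by simp
  calc _ ≤ (n : ℝ)⁻¹ * ((n : ℝ)⁻¹ * (n * A ^ 2)) := by gcongr
    _ = A ^ 2 / n := by field_simp

/-- Concentration of the empirical mean of bounded Hilbert space valued variables around their
weak mean. -/
theorem exists_event_norm_empirical_sub_le (Q : Measure 𝒳) [IsProbabilityMeasure Q] {Z : 𝒳 → E}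
    {μ : E} {A : ℝ} (hApos : 0 < A) (hA : ∀ x, ‖Z x‖ ≤ A)
    (hZ : ∀ v, Measurable fun x => inner ℝ v (Z x))
    (hZZ : Measurable fun p : 𝒳 × 𝒳 => inner ℝ (Z p.1) (Z p.2))
    (hμ : ∀ v, ∫ x, inner ℝ v (Z x) ∂Q = inner ℝ v μ) {n : ℕ} (hn : 0 < n)
    {Ω : Type*} [MeasurableSpace Ω] (P : Measure Ω) [IsProbabilityMeasure P]
    (X : Fin n → Ω → 𝒳) (hX : ∀ i, Measurable (X i)) (hind : iIndepFun X P)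
    (hlaw : ∀ i, P.map (X i) = Q) {δ : ℝ} (hδ : 0 < δ) (hδ1 : δ ≤ 1) :
    ∃ S : Set Ω, MeasurableSet S ∧ P.real Sᶜ ≤ δ ∧ ∀ ω ∈ S,
      ‖(n : ℝ)⁻¹ • ∑ i, Z (X i ω) - μ‖ ≤ A * (1 + √(2 * Real.log (1 / δ))) / √n := by
  have hn' : (0 : ℝ) < n := by exact_mod_cast hn
  set ν := Measure.pi (fun _ : Fin n => Q) with hν
  set f : (Fin n → 𝒳) → ℝ := fun x => ‖(n : ℝ)⁻¹ • ∑ i, Z (x i) - μ‖ with hf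
  have hfm : Measurable f := measurable_norm_empirical_sub hZ hZZ n
  have hfC : ∀ x, |f x| ≤ A + ‖μ‖ := fun x => by
    rw [hf, abs_of_nonneg (norm_nonneg _)]
    refine (norm_sub_le _ _).trans ?_
    gcongr
    rw [norm_smul, norm_inv, Real.norm_natCast, inv_mul_le_iff₀ hn']
    exact (norm_sum_le _ _).trans ((Finset.sum_le_sum fun i _ => hA _).trans (by simp))
  have hfc : ∀ x i y, |f (Function.update x i y) - f x| ≤ 2 * A / n := fun x i y => by
    refine (abs_norm_sub_norm_le _ _).trans ?_
    rw [sub_sub_sub_cancel_right, ← smul_sub, ← Finset.sum_sub_distrib, Finset.sum_eq_single i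
      (fun j _ hj => by simp [Function.update_of_ne hj]) (by simp), norm_smul, norm_inv,
      Real.norm_natCast, inv_mul_le_iff₀ hn']
    refine (norm_sub_le _ _).trans ?_
    have := hA (Function.update x i y i)
    have := hA (x i)
    field_simp
    linarith
  -- Nonnegativity of the variance bounds the squared mean by the second moment.
  have hmean : ∫ x, f x ∂ν ≤ A / √n := by
    have h2 : ∫ x, f x ^ 2 ∂ν ≤ A ^ 2 / n :=
      integral_norm_sq_empirical_sub_le Q hA hZ hZZ hμ hn
    have hLp : MemLp f 2 ν := MemLp.of_bound hfm.aestronglyMeasurable (A + ‖μ‖)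
      (Filter.Eventually.of_forall hfC)
    have hvar := variance_nonneg f ν
    rw [variance_eq_sub hLp] at hvar
    have : (∫ x, f x ∂ν) ^ 2 ≤ (A / √n) ^ 2 := by
      rw [div_pow, Real.sq_sqrt hn'.le]
      refine le_trans ?_ h2
      simpa using hvar
    exact le_of_sq_le_sq this (by positivity)
  -- Chosen so that the McDiarmid tail with differences `2 * A / n` is exactly `δ`.
  set s := A * √(2 * Real.log (1 / δ)) / √n with hs
  have hlog : 0 ≤ Real.log (1 / δ) := Real.log_nonneg (by rw [le_div_iff₀ hδ]; linarith)
  have htail := measure_pi_ge_le_of_bounded_differences Q (2 * A / n) n f hfm (A + ‖μ‖) hfC hfc s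
    (by positivity)
  have hexp : Real.exp (-s ^ 2 / (2 * (n * (2 * A / n / 2) ^ 2))) = δ := by
    have : -s ^ 2 / (2 * (n * (2 * A / n / 2) ^ 2)) = Real.log δ := by
      rw [hs, div_pow, mul_pow, Real.sq_sqrt (by positivity), Real.sq_sqrt hn'.le]
      rw [one_div, Real.log_inv]
      field_simp
    rw [this, Real.exp_log hδ]
  rw [hexp] at htail
  have hXm : Measurable fun ω i => X i ω := measurable_pi_lambda _ hX
  have hmap : P.map (fun ω i => X i ω) = ν := by
    rw [hind.map_fun_eq_pi_map fun i => (hX i).aemeasurable]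
    simp only [hlaw, hν]
  have hTm : MeasurableSet {x | s ≤ f x - ∫ z, f z ∂ν} :=
    measurableSet_le measurable_const (hfm.sub_const _)
  refine ⟨((fun ω i => X i ω) ⁻¹' {x | s ≤ f x - ∫ z, f z ∂ν})ᶜ, (hXm hTm).compl, ?_,
    fun ω hω => ?_⟩
  · rw [compl_compl]
    rwa [← hν, ← hmap, map_measureReal_apply hXm (by rwa [hmap]), hmap] at htail
  · have h1 : f (fun i => X i ω) - ∫ z, f z ∂ν < s := by simpa using hω
    calc f (fun i => X i ω) ≤ s + A / √n := by linarith
      _ = _ := by rw [hs]; ring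

end Concentration

namespace MixtureProportion

/-! ### Feature vectors and kernel mean embeddings -/

section RKHS

variable {𝒳 : Type*} {𝓗 : Type*} [NormedAddCommGroup 𝓗] [InnerProductSpace ℝ 𝓗]
  [CompleteSpace 𝓗] [RKHS ℝ 𝓗 𝒳 ℝ]

theorem inner_featureMap (h : 𝓗) (x : 𝒳) : inner ℝ h (featureMap 𝓗 x) = h x := by
  simp [featureMap]

theorem inner_featureMap_featureMap (x y : 𝒳) :
    inner ℝ (featureMap 𝓗 x) (featureMap 𝓗 y) = realKernel 𝓗 x y := by
  rw [real_inner_comm, inner_featureMap, featureMap, RKHS.kerFun_apply, realKernel]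

theorem norm_featureMap_le_one (hk_le : ∀ x : 𝒳, realKernel 𝓗 x x ≤ 1) (x : 𝒳) :
    ‖featureMap 𝓗 x‖ ≤ 1 := by
  have h := hk_le x
  rw [← inner_featureMap_featureMap, real_inner_self_eq_norm_sq] at h
  exact (sq_le_one_iff₀ (norm_nonneg _)).1 h

theorem abs_apply_le_norm (hk_le : ∀ x : 𝒳, realKernel 𝓗 x x ≤ 1) (h : 𝓗) (x : 𝒳) :
    |h x| ≤ ‖h‖ := by
  rw [← inner_featureMap]
  refine (abs_real_inner_le_norm _ _).trans (mul_le_of_le_one_right (norm_nonneg _) ?_)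
  exact norm_featureMap_le_one hk_le x

variable [MeasurableSpace 𝒳]

/-- The elements of a reproducing kernel Hilbert space with measurable kernel are measurable. -/
theorem measurable_coe
    (hk_meas : Measurable (fun p : 𝒳 × 𝒳 => realKernel 𝓗 p.1 p.2)) (h : 𝓗) :
    Measurable (h : 𝒳 → ℝ) := by
  have hspan : ∀ f ∈ Submodule.span ℝ {RKHS.kerFun 𝓗 x v | (x : 𝒳) (v : ℝ)},
      Measurable (f : 𝒳 → ℝ) := fun f hf => by
    induction hf using Submodule.span_induction with
    | mem f hf =>
      obtain ⟨x, v, rfl⟩ := hf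
      have hxv : (RKHS.kerFun 𝓗 x v : 𝓗) = v • featureMap 𝓗 x := by
        rw [featureMap, ← map_smul, smul_eq_mul, mul_one]
      rw [hxv, RKHS.coe_smul]
      have hx : (featureMap 𝓗 x : 𝒳 → ℝ) = fun y => realKernel 𝓗 y x := by
        ext y
        rw [featureMap, RKHS.kerFun_apply, realKernel]
      rw [hx]
      exact (hk_meas.comp (measurable_id.prodMk measurable_const)).const_smul v
    | zero => rw [RKHS.coe_zero]; exact measurable_zero
    | add f g _ _ hf hg => rw [RKHS.coe_add]; exact hf.add hg
    | smul a f _ hf => rw [RKHS.coe_smul]; exact hf.const_smul a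
  -- Kernel sections span a dense subspace, and norm convergence implies pointwise convergence,
  -- which preserves measurability.
  have hmem : h ∈ closure ((Submodule.span ℝ {RKHS.kerFun 𝓗 x v | (x : 𝒳) (v : ℝ)} :
      Submodule ℝ 𝓗) : Set 𝓗) := by
    rw [← Submodule.topologicalClosure_coe, RKHS.kerFun_dense]
    trivial
  obtain ⟨u, hu, hlim⟩ := mem_closure_iff_seq_limit.1 hmem
  exact measurable_of_tendsto_metrizable (fun i => hspan _ (hu i))
    (tendsto_pi_nhds.2 fun x => ((RKHS.continuous_eval x).tendsto h).comp hlim)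

theorem integrable_coe (hk_meas : Measurable (fun p : 𝒳 × 𝒳 => realKernel 𝓗 p.1 p.2))
    (hk_le : ∀ x : 𝒳, realKernel 𝓗 x x ≤ 1) (Q : Measure 𝒳) [IsFiniteMeasure Q] (h : 𝓗) :
    Integrable (h : 𝒳 → ℝ) Q :=
  Integrable.of_bound (measurable_coe hk_meas h).aestronglyMeasurable ‖h‖
    (Filter.Eventually.of_forall (abs_apply_le_norm hk_le h))

/-- The kernel mean embedding of a probability measure, as a weak integral. -/
theorem exists_meanEmbedding (hk_meas : Measurable (fun p : 𝒳 × 𝒳 => realKernel 𝓗 p.1 p.2))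
    (hk_le : ∀ x : 𝒳, realKernel 𝓗 x x ≤ 1) (Q : Measure 𝒳) [IsProbabilityMeasure Q] :
    ∃ μ : 𝓗, ∀ h : 𝓗, ∫ x, h x ∂Q = inner ℝ h μ := by
  let L : 𝓗 →ₗ[ℝ] ℝ :=
    { toFun := fun h => ∫ x, h x ∂Q
      map_add' := fun f g => by
        rw [← integral_add (integrable_coe hk_meas hk_le Q f) (integrable_coe hk_meas hk_le Q g),
          RKHS.coe_add]
        rfl
      map_smul' := fun c f => by
        rw [RingHom.id_apply, ← integral_smul, RKHS.coe_smul]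
        rfl }
  -- Integration is a functional of norm at most one; the embedding is its Riesz representative.
  let T : 𝓗 →L[ℝ] ℝ := L.mkContinuous 1 fun h => by
    have := norm_integral_le_of_norm_le_const (μ := Q) (f := (h : 𝒳 → ℝ)) (C := ‖h‖)
      (Filter.Eventually.of_forall (abs_apply_le_norm hk_le h))
    simpa [L] using this
  refine ⟨(InnerProductSpace.toDual ℝ 𝓗).symm T, fun h => ?_⟩
  rw [real_inner_comm, InnerProductSpace.toDual_symm_apply]
  rfl

/-- Concentration of weighted empirical means of feature vectors around their weak mean. -/
theorem exists_event_norm_weighted_featureMap_sub_le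
    (hk_meas : Measurable (fun p : 𝒳 × 𝒳 => realKernel 𝓗 p.1 p.2))
    (hk_le : ∀ x : 𝒳, realKernel 𝓗 x x ≤ 1) (Q : Measure 𝒳) [IsProbabilityMeasure Q]
    {a : 𝒳 → ℝ} (ha : Measurable a) {A : ℝ} (hA : 0 < A) (haA : ∀ x, |a x| ≤ A) {μ : 𝓗}
    (hμ : ∀ h : 𝓗, ∫ x, a x * h x ∂Q = inner ℝ h μ) {n : ℕ} (hn : 0 < n)
    {Ω : Type*} [MeasurableSpace Ω] (P : Measure Ω) [IsProbabilityMeasure P]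
    (X : Fin n → Ω → 𝒳) (hX : ∀ i, Measurable (X i)) (hind : iIndepFun X P)
    (hlaw : ∀ i, P.map (X i) = Q) {δ : ℝ} (hδ : 0 < δ) (hδ1 : δ ≤ 1) :
    ∃ S : Set Ω, MeasurableSet S ∧ P.real Sᶜ ≤ δ ∧ ∀ ω ∈ S,
      ‖(n : ℝ)⁻¹ • ∑ i, a (X i ω) • featureMap 𝓗 (X i ω) - μ‖
        ≤ A * (1 + √(2 * Real.log (1 / δ))) / √n := by
  refine exists_event_norm_empirical_sub_le Q (Z := fun x => a x • featureMap 𝓗 x) hA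
    (fun x => ?_) (fun v => ?_) ?_ (fun v => ?_) hn P X hX hind hlaw hδ hδ1
  · rw [norm_smul]
    exact (mul_le_of_le_one_right (norm_nonneg _) (norm_featureMap_le_one hk_le x)).trans (haA x)
  · simp only [real_inner_smul_right, inner_featureMap]
    exact ha.mul (measurable_coe hk_meas v)
  · simp only [real_inner_smul_right, real_inner_smul_left, inner_featureMap_featureMap]
    exact (ha.comp measurable_snd).mul ((ha.comp measurable_fst).mul hk_meas)
  · simpa only [real_inner_smul_right, inner_featureMap] using hμ v

end RKHS

/-! ### Density of a mixture component -/

section Density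

/-- A component of a mixture has a density with values in `[0, 1]`. -/
theorem exists_density_of_le {𝒳 : Type*} [MeasurableSpace 𝒳] (M F : Measure 𝒳)
    [IsFiniteMeasure M] [IsFiniteMeasure F] (hle : M ≤ F) :
    ∃ p : 𝒳 → ℝ, Measurable p ∧ (∀ x, 0 ≤ p x) ∧ (∀ x, p x ≤ 1) ∧
      ∀ f : 𝒳 → ℝ, ∫ x, f x ∂M = ∫ x, p x * f x ∂F := by
  -- The truncation changes the derivative only on a null set and makes the bound hold everywhere.
  refine ⟨fun x => min (M.rnDeriv F x).toReal 1, (M.measurable_rnDeriv F).ennreal_toReal.min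
    measurable_const, fun x => le_min ENNReal.toReal_nonneg zero_le_one, fun x => min_le_right _ _,
    fun f => ?_⟩
  rw [← integral_rnDeriv_smul (Measure.absolutelyContinuous_of_le hle)]
  refine integral_congr_ae ?_
  filter_upwards [Measure.rnDeriv_le_one_of_le hle] with x hx
  rw [min_eq_left, smul_eq_mul]
  exact ENNReal.toReal_le_of_le_ofReal zero_le_one (by simpa using hx)

end Density

/-! ### Geometry of the sample hull -/

section Deterministic

variable {𝒳 : Type*} {𝓗 : Type*} [NormedAddCommGroup 𝓗] [InnerProductSpace ℝ 𝓗]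
  [CompleteSpace 𝓗] [RKHS ℝ 𝓗 𝒳 ℝ] {n m : ℕ} (x : Fin n → 𝒳) (y : Fin m → 𝒳)

theorem convex_sampleHull : Convex ℝ (sampleHull 𝓗 x y) := by
  rintro _ ⟨a, ha, rfl⟩ _ ⟨b, hb, rfl⟩ s t hs ht hst
  refine ⟨s • a + t • b, convex_stdSimplex ℝ _ ha hb hs ht hst, ?_⟩
  simp only [Finset.smul_sum, smul_smul, ← Finset.sum_add_distrib, ← add_smul, Pi.add_apply,
    Pi.smul_apply, smul_eq_mul]

variable {x} in
theorem weighted_left_mem_sampleHull {a : Fin n → ℝ} (ha : ∀ i, 0 ≤ a i) (h1 : ∑ i, a i = 1) :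
    ∑ i, a i • featureMap 𝓗 (x i) ∈ sampleHull 𝓗 x y := by
  refine ⟨Sum.elim a 0, ⟨?_, ?_⟩, ?_⟩
  · rintro (i | j)
    · exact ha i
    · exact le_rfl
  · simpa using h1
  · simp

theorem empiricalMean_left_mem_sampleHull (hn : 0 < n) :
    empiricalMean 𝓗 x ∈ sampleHull 𝓗 x y := by
  have hn' : (n : ℝ) ≠ 0 := by positivity
  rw [empiricalMean, Finset.smul_sum]
  exact weighted_left_mem_sampleHull y (fun _ => by positivity) (by simp [hn'])

theorem empiricalMean_right_mem_sampleHull (hm : 0 < m) :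
    empiricalMean 𝓗 y ∈ sampleHull 𝓗 x y := by
  have hm' : (m : ℝ) ≠ 0 := by positivity
  refine ⟨Sum.elim 0 fun _ => (m : ℝ)⁻¹, ⟨?_, ?_⟩, ?_⟩
  · rintro (i | j)
    · exact le_rfl
    · exact inv_nonneg.2 m.cast_nonneg
  · simp [hm']
  · simp [empiricalMean, Finset.smul_sum]

theorem norm_le_one_of_mem_sampleHull (hk_le : ∀ x : 𝒳, realKernel 𝓗 x x ≤ 1) {w : 𝓗}
    (hw : w ∈ sampleHull 𝓗 x y) : ‖w‖ ≤ 1 := by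
  obtain ⟨a, ⟨ha0, ha1⟩, rfl⟩ := hw
  refine (norm_sum_le _ _).trans ?_
  rw [← ha1]
  refine Finset.sum_le_sum fun i _ => ?_
  rw [norm_smul, Real.norm_of_nonneg (ha0 i)]
  exact mul_le_of_le_one_right (ha0 i) (norm_featureMap_le_one hk_le _)

theorem iInf_le_inner_of_mem_sampleHull (hk_le : ∀ x : 𝒳, realKernel 𝓗 x x ≤ 1) (h : 𝓗) {w : 𝓗}
    (hw : w ∈ sampleHull 𝓗 x y) : ⨅ z : 𝒳, h z ≤ inner ℝ h w := by
  obtain ⟨a, ⟨ha0, ha1⟩, rfl⟩ := hw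
  have hb : BddBelow (Set.range (h : 𝒳 → ℝ)) :=
    ⟨-‖h‖, by rintro _ ⟨z, rfl⟩; exact (abs_le.1 (abs_apply_le_norm hk_le h z)).1⟩
  simp only [inner_sum, real_inner_smul_right, inner_featureMap]
  calc ⨅ z : 𝒳, h z = ∑ i, a i * ⨅ z : 𝒳, h z := by rw [← Finset.sum_mul, ha1, one_mul]
    _ ≤ _ := Finset.sum_le_sum fun i _ => mul_le_mul_of_nonneg_left (ciInf_le hb _) (ha0 i)

theorem empiricalDist_le {w : 𝓗} (hw : w ∈ sampleHull 𝓗 x y) (l : ℝ) :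
    empiricalDist 𝓗 x y l ≤ ‖l • empiricalMean 𝓗 x + (1 - l) • empiricalMean 𝓗 y - w‖ :=
  ciInf_le (f := fun w : sampleHull 𝓗 x y =>
    ‖l • empiricalMean 𝓗 x + (1 - l) • empiricalMean 𝓗 y - (w : 𝓗)‖)
    ⟨0, by rintro _ ⟨v, rfl⟩; exact norm_nonneg _⟩ ⟨w, hw⟩

/-- A bound on the empirical distance at `Λ ≥ 1` is strict at every smaller nonnegative
argument. -/
theorem empiricalDist_lt (hn : 0 < n) (hm : 0 < m) {Λ τ : ℝ} (hτ : 0 < τ) {w : 𝓗}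
    (hw : w ∈ sampleHull 𝓗 x y)
    (hwτ : ‖Λ • empiricalMean 𝓗 x + (1 - Λ) • empiricalMean 𝓗 y - w‖ ≤ τ) {l : ℝ} (hl : 0 ≤ l)
    (hlΛ : l < Λ) : empiricalDist 𝓗 x y l < τ := by
  have hx := empiricalMean_left_mem_sampleHull (𝓗 := 𝓗) x y hn
  have hy := empiricalMean_right_mem_sampleHull (𝓗 := 𝓗) x y hm
  -- For `l ≤ 1` the point lies in the hull. For `l > 1` it lies on the segment from the first
  -- empirical mean to the extrapolation at `Λ`; moving `w` along the same way shrinks the distance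
  -- by `t < 1`.
  rcases le_or_gt l 1 with h1 | h1
  · have hmem := convex_sampleHull (𝓗 := 𝓗) x y hx hy hl (sub_nonneg.2 h1) (by ring)
    refine (empiricalDist_le x y hmem l).trans_lt ?_
    simpa using hτ
  · have hΛ : 0 < Λ - 1 := by linarith
    set t := (l - 1) / (Λ - 1) with ht
    have ht0 : 0 ≤ t := div_nonneg (by linarith) hΛ.le
    have ht1 : t < 1 := by rw [ht, div_lt_one hΛ]; linarith
    have hlt : l = (1 - t) + t * Λ := by rw [ht]; field_simp; ring
    have hmem := convex_sampleHull (𝓗 := 𝓗) x y hx hw (sub_nonneg.2 ht1.le) ht0 (by ring)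
    refine (empiricalDist_le x y hmem l).trans_lt ?_
    have heq : l • empiricalMean 𝓗 x + (1 - l) • empiricalMean 𝓗 y
        - ((1 - t) • empiricalMean 𝓗 x + t • w)
        = t • (Λ • empiricalMean 𝓗 x + (1 - Λ) • empiricalMean 𝓗 y - w) := by
      rw [hlt]
      module
    rw [heq, norm_smul, Real.norm_of_nonneg ht0]
    calc t * _ ≤ t * τ := by gcongr
      _ < τ := by nlinarith

/-- If the weights `g i` reweight the sample `x` approximately to the mixture component that is
left when `H` is removed, the extrapolation at `Λ` is close to the sample hull. -/
theorem exists_mem_sampleHull_norm_sub_le (hk_le : ∀ x : 𝒳, realKernel 𝓗 x x ≤ 1) (hn : 0 < n)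
    {Λ ε : ℝ} (hΛ : 1 ≤ Λ) {g : Fin n → ℝ} (hg : ∀ i, 0 ≤ g i) {μ : 𝓗}
    (hy : ‖empiricalMean 𝓗 y - μ‖ ≤ ε)
    (hx : ‖(n : ℝ)⁻¹ • ∑ i, (Λ - g i) • featureMap 𝓗 (x i) - (Λ - 1) • μ‖ ≤ Λ * ε)
    (hs : |(n : ℝ)⁻¹ * ∑ i, g i - 1| ≤ Λ / 2 * ε) (hsmall : Λ / 2 * ε < 1) :
    ∃ w ∈ sampleHull 𝓗 x y, ‖Λ • empiricalMean 𝓗 x + (1 - Λ) • empiricalMean 𝓗 y - w‖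
      ≤ (5 / 2 * Λ - 1) * ε := by
  set s := (n : ℝ)⁻¹ * ∑ i, g i with hsdef
  have hs0 : 0 < s := by linarith [(abs_le.1 hs).1]
  set w := ∑ i, (s⁻¹ * ((n : ℝ)⁻¹ * g i)) • featureMap 𝓗 (x i) with hw
  have hmem : w ∈ sampleHull 𝓗 x y := by
    refine weighted_left_mem_sampleHull y (fun i => ?_) ?_
    · have := hg i
      positivity
    · rw [← Finset.mul_sum, ← Finset.mul_sum, ← hsdef, inv_mul_cancel₀ hs0.ne']
  refine ⟨w, hmem, ?_⟩
  have hsw : s • w = (n : ℝ)⁻¹ • ∑ i, g i • featureMap 𝓗 (x i) := by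
    simp only [hw, Finset.smul_sum, smul_smul]
    refine Finset.sum_congr rfl fun i _ => ?_
    rw [mul_inv_cancel_left₀ hs0.ne']
  have hsub : (n : ℝ)⁻¹ • ∑ i, (Λ - g i) • featureMap 𝓗 (x i)
      = Λ • empiricalMean 𝓗 x - s • w := by
    rw [hsw, empiricalMean]
    simp only [sub_smul, Finset.sum_sub_distrib, ← Finset.smul_sum, smul_sub]
    rw [smul_comm]
  -- The three errors cost `Λ * ε`, `(Λ - 1) * ε` and `Λ / 2 * ε`. Treating `(Λ - g) φ` as one
  -- variable bounded by `Λ` avoids paying separately for `Λ φ` and `g φ`.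
  have heq : Λ • empiricalMean 𝓗 x + (1 - Λ) • empiricalMean 𝓗 y - w
      = ((n : ℝ)⁻¹ • ∑ i, (Λ - g i) • featureMap 𝓗 (x i) - (Λ - 1) • μ)
        - (Λ - 1) • (empiricalMean 𝓗 y - μ) + (s - 1) • w := by
    rw [hsub]
    module
  rw [heq]
  refine (norm_add_le _ _).trans ((add_le_add_left (norm_sub_le _ _) _).trans ?_)
  rw [norm_smul, norm_smul, Real.norm_of_nonneg (sub_nonneg.2 hΛ), Real.norm_eq_abs]
  have h1 : (Λ - 1) * ‖empiricalMean 𝓗 y - μ‖ ≤ (Λ - 1) * ε :=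
    mul_le_mul_of_nonneg_left hy (sub_nonneg.2 hΛ)
  have h2 : |s - 1| * ‖w‖ ≤ Λ / 2 * ε :=
    (mul_le_of_le_one_right (abs_nonneg _) (norm_le_one_of_mem_sampleHull x y hk_le hmem)).trans hs
  linarith

/-- Lower bound on the empirical distance from a witness `h` in the unit ball. -/
theorem le_empiricalDist (hk_le : ∀ x : 𝒳, realKernel 𝓗 x x ≤ 1) (hn : 0 < n) {h μF μH : 𝓗}
    (hh : ‖h‖ ≤ 1) {ε l : ℝ} (hl : 1 ≤ l) (hx : ‖empiricalMean 𝓗 x - μF‖ ≤ ε)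
    (hy : ‖empiricalMean 𝓗 y - μH‖ ≤ ε) :
    (⨅ z : 𝒳, h z) - l * inner ℝ h μF - (1 - l) * inner ℝ h μH - (2 * l - 1) * ε
      ≤ empiricalDist 𝓗 x y l := by
  have : Nonempty (sampleHull 𝓗 x y) := ⟨⟨_, empiricalMean_left_mem_sampleHull x y hn⟩⟩
  refine le_ciInf fun ⟨w, hw⟩ => ?_
  have h1 : ∀ v : 𝓗, |inner ℝ h v| ≤ ‖v‖ := fun v =>
    (abs_real_inner_le_norm _ _).trans (mul_le_of_le_one_left (norm_nonneg _) hh)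
  have h2 := (abs_le.1 (h1 (l • empiricalMean 𝓗 x + (1 - l) • empiricalMean 𝓗 y - w))).1
  have h3 := (abs_le.1 ((h1 _).trans hx)).2
  have h4 := (abs_le.1 ((h1 _).trans hy)).1
  have h5 := iInf_le_inner_of_mem_sampleHull x y hk_le h hw
  simp only [inner_sub_right, inner_add_right, real_inner_smul_right] at h2 h3 h4
  have h6 := mul_le_mul_of_nonneg_left h3 (by linarith : 0 ≤ l)
  have h7 := mul_le_mul_of_nonneg_left h4 (by linarith : 0 ≤ l - 1)
  simp only
  linarith

end Deterministic

/-! ### Numerical estimates -/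

section Estimates

/-- Makes the lower bound on `τ` at least `6 * Λ * L`, where `L` is the rate `√(log (1/δ)) / √(min m
n)`; this covers `(5 / 2 * Λ - 1) * (12 / 5 * L)`. -/
theorem two_le_two_sub_inv_add_sqrt {Λ : ℝ} (hΛ : 1 ≤ Λ) : 2 ≤ 2 - 1 / Λ + √(2 / Λ) := by
  have h : 1 / Λ ≤ √(2 / Λ) := by
    apply Real.le_sqrt_of_sq_le
    have : 1 / Λ ≤ 1 := by rw [div_le_one (by linarith)]; exact hΛ
    have : 0 ≤ 1 / Λ := by positivity
    have : 2 / Λ = 2 * (1 / Λ) := by ring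
    nlinarith
  linarith

theorem two_sub_inv_add_sqrt_le {Λ : ℝ} (hΛ : 1 ≤ Λ) : 2 - 1 / Λ + √(2 / Λ) ≤ 5 / 2 := by
  have h : √(2 / Λ) ≤ 1 / Λ + 1 / 2 := by
    have h0 : 0 ≤ 1 / Λ := by positivity
    rw [Real.sqrt_le_iff]
    refine ⟨by linarith, ?_⟩
    have : 2 / Λ = 2 * (1 / Λ) := by ring
    nlinarith [sq_nonneg (1 / Λ - 1 / 2)]
  linarith

/-- As `δ ≤ 1 / 4`, the logarithm is at least `log 4 > 1.38`, so its root can absorb the `1`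
contributed by the expected norm. -/
theorem one_add_sqrt_two_mul_log_le {δ : ℝ} (hδ : 0 < δ) (hδ4 : δ ≤ 1 / 4) :
    1 + √(2 * Real.log (1 / δ)) ≤ 12 / 5 * √(Real.log (1 / δ)) := by
  have hlog : 1.38 ≤ Real.log (1 / δ) := by
    have h4 : (2 : ℝ) ^ 2 ≤ 1 / δ := by rw [le_div_iff₀ hδ]; linarith
    have := Real.log_le_log (by norm_num) h4
    rw [Real.log_pow] at this
    push_cast at this
    linarith [Real.log_two_gt_d9]
  set r := √(Real.log (1 / δ)) with hr
  have hr1 : 1.17 ≤ r := Real.le_sqrt_of_sq_le (by linarith)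
  have h2 : √2 ≤ 1.42 := by
    rw [Real.sqrt_le_iff]
    norm_num
  rw [Real.sqrt_mul (by norm_num), ← hr]
  have := mul_le_mul_of_nonneg_right h2 (by linarith : 0 ≤ r)
  linarith

/-- The threshold is exceeded at a point exceeding `Λ` by at most the claimed error. -/
theorem exists_threshold_crossing {Λ α β L τ u : ℝ} (hΛ : 1 ≤ Λ) (hα : 0 < α) (hα2 : α ≤ 2)
    (hβ : 0 ≤ β) (hL : 0 ≤ L) (hLα : 12 * Λ * L < α) (hτ : 0 ≤ τ) (hu : u ≤ 5 / 2)
    (hτu : τ ≤ 6 * Λ * L * u) :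
    ∃ l, Λ ≤ l ∧ τ ≤ (l / Λ - 1) * α - β - (2 * l - 1) * (12 / 5 * L) ∧
      l - Λ ≤ β * Λ / α
        + (6 * α * Λ ^ 2 * u + 2 * Λ * (3 * α + 6 * Λ * (2 + α + β))) / α ^ 2 * L := by
  have hΛ0 : 0 < Λ := by linarith
  have hD : 0 < α - 24 / 5 * Λ * L := by nlinarith
  have hDα : 3 / 5 * α ≤ α - 24 / 5 * Λ * L := by nlinarith
  set D := α - 24 / 5 * Λ * L with hDdef
  -- `Λ + r` solves the linear equation in `l` that makes the lower bound on the distance equal to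
  -- `τ`.
  set r := Λ * (τ + β + (2 * Λ - 1) * (12 / 5 * L)) / D with hr
  have hr0 : 0 ≤ r := by
    have : 0 ≤ 2 * Λ - 1 := by linarith
    positivity
  refine ⟨Λ + r, by linarith, le_of_eq ?_, ?_⟩
  · have hrD : r * D = Λ * (τ + β + (2 * Λ - 1) * (12 / 5 * L)) := div_mul_cancel₀ _ hD.ne'
    have : (Λ + r) / Λ - 1 = r / Λ := by field_simp; ring
    rw [this]
    have h2 : r / Λ * α = (r * D + r * (24 / 5 * Λ * L)) / Λ := by rw [hDdef]; ring
    rw [h2, hrD]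
    field_simp
    ring
  -- The `β` term must keep its leading coefficient `Λ / α`, so `1 / D` is expanded to first order;
  -- `8` is the least slope valid up to `Λ * L = α / 12`. The other terms already carry a factor
  -- `L`, and the cruder `D ≥ 3 / 5 * α` suffices.
  · have hb : Λ * β / D ≤ β * Λ / α + 8 * Λ ^ 2 * β * L / α ^ 2 := by
      have : β * Λ / α + 8 * Λ ^ 2 * β * L / α ^ 2
          = Λ * β * (α + 8 * Λ * L) / α ^ 2 := by field_simp
      rw [this, div_le_div_iff₀ hD (by positivity), mul_assoc (Λ * β)]
      refine mul_le_mul_of_nonneg_left ?_ (mul_nonneg hΛ0.le hβ)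
      have h0 : 0 ≤ Λ * L := mul_nonneg hΛ0.le hL
      nlinarith
    have hD' : ∀ a, 0 ≤ a → a / D ≤ 5 / 3 * a / α := fun a ha => by
      rw [div_le_div_iff₀ hD hα]
      nlinarith
    have ht : Λ * τ / D ≤ 10 * Λ ^ 2 * L * u / α := by
      refine (hD' _ (by positivity)).trans (div_le_div_of_nonneg_right ?_ hα.le)
      linarith [mul_le_mul_of_nonneg_left hτu hΛ0.le]
    have he : Λ * ((2 * Λ - 1) * (12 / 5 * L)) / D ≤ (8 * Λ ^ 2 - 4 * Λ) * L / α := by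
      have : 0 ≤ 2 * Λ - 1 := by linarith
      refine (hD' _ (by positivity)).trans (le_of_eq ?_)
      ring
    have hsplit : r = Λ * β / D + Λ * τ / D + Λ * ((2 * Λ - 1) * (12 / 5 * L)) / D := by
      rw [hr]; ring
    have hfin : 8 * Λ ^ 2 * β * L / α ^ 2 + 10 * Λ ^ 2 * L * u / α
        + (8 * Λ ^ 2 - 4 * Λ) * L / α
        ≤ (6 * α * Λ ^ 2 * u + 2 * Λ * (3 * α + 6 * Λ * (2 + α + β))) / α ^ 2 * L := by
      have h1 : 8 * Λ ^ 2 * β * L / α ^ 2 + 10 * Λ ^ 2 * L * u / α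
          + (8 * Λ ^ 2 - 4 * Λ) * L / α
          = (8 * Λ ^ 2 * β + 10 * Λ ^ 2 * u * α + (8 * Λ ^ 2 - 4 * Λ) * α) / α ^ 2 * L := by
        field_simp
      rw [h1]
      refine mul_le_mul_of_nonneg_right (div_le_div_of_nonneg_right ?_ (sq_nonneg α)) hL
      have e1 : 0 ≤ Λ ^ 2 * β := by positivity
      have e2 : Λ ^ 2 * α * u ≤ Λ ^ 2 * α * (5 / 2) := by gcongr
      have e3 : Λ ^ 2 * α ≤ Λ ^ 2 * 2 := by gcongr
      have e4 : 0 ≤ Λ * α := by positivity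
      have e5 : 0 ≤ Λ ^ 2 * α := by positivity
      linarith
    linarith

end Estimates

/-! ### Concentration of the four empirical means -/

/-- The event on which all the empirical means of the two samples that the analysis of the value
thresholding estimator needs are close to their weak means. -/
theorem exists_concentration_event
    {𝒳 : Type*} [MeasurableSpace 𝒳]
    {𝓗 : Type*} [NormedAddCommGroup 𝓗] [InnerProductSpace ℝ 𝓗] [CompleteSpace 𝓗]
    [RKHS ℝ 𝓗 𝒳 ℝ]
    (hk_meas : Measurable (fun p : 𝒳 × 𝒳 => realKernel 𝓗 p.1 p.2))
    (hk_le : ∀ x : 𝒳, realKernel 𝓗 x x ≤ 1)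
    (F H : Measure 𝒳) [IsProbabilityMeasure F] [IsProbabilityMeasure H]
    {p : 𝒳 → ℝ} (hp : Measurable p) (hp0 : ∀ x, 0 ≤ p x) (hp1 : ∀ x, p x ≤ 1)
    {Λ : ℝ} (hΛ : 1 ≤ Λ) (hpΛ : Λ * ∫ x, p x ∂F = 1)
    {μF μH : 𝓗} (hμF : ∀ h : 𝓗, ∫ x, h x ∂F = inner ℝ h μF)
    (hμH : ∀ h : 𝓗, ∫ x, h x ∂H = inner ℝ h μH)
    (hpH : ∀ h : 𝓗, ∫ x, (Λ - Λ * p x) * h x ∂F = (Λ - 1) * ∫ x, h x ∂H)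
    {δ : ℝ} (hδ_pos : 0 < δ) (hδ_le : δ ≤ 1 / 4)
    {Ω : Type*} [MeasurableSpace Ω] (P : Measure Ω) [IsProbabilityMeasure P]
    {n m : ℕ} (hn : 0 < n) (hm : 0 < m) (X : Fin n → Ω → 𝒳) (Y : Fin m → Ω → 𝒳)
    (hX_meas : ∀ i, Measurable (X i)) (hX_indep : iIndepFun X P) (hX_law : ∀ i, P.map (X i) = F)
    (hY_meas : ∀ j, Measurable (Y j)) (hY_indep : iIndepFun Y P)
    (hY_law : ∀ j, P.map (Y j) = H) {ε : ℝ}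
    (hε : ε = 12 / 5 * (√(Real.log (1 / δ)) / √((min m n : ℕ) : ℝ))) :
    ∃ S : Set Ω, MeasurableSet S ∧ ENNReal.ofReal (1 - 4 * δ) ≤ P S ∧ ∀ ω ∈ S,
      ‖empiricalMean 𝓗 (fun i => X i ω) - μF‖ ≤ ε ∧
      ‖empiricalMean 𝓗 (fun j => Y j ω) - μH‖ ≤ ε ∧
      ‖(n : ℝ)⁻¹ • ∑ i, (Λ - Λ * p (X i ω)) • featureMap 𝓗 (X i ω) - (Λ - 1) • μH‖ ≤ Λ * ε ∧
      |(n : ℝ)⁻¹ * ∑ i, Λ * p (X i ω) - 1| ≤ Λ / 2 * ε := by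
  have hΛ0 : 0 < Λ := by linarith
  have hδ1 : δ ≤ 1 := by linarith
  have hmin : (0 : ℝ) < ((min m n : ℕ) : ℝ) := by exact_mod_cast lt_min hm hn
  have hrate : ∀ (A : ℝ) (N : ℕ), 0 ≤ A → min m n ≤ N →
      A * (1 + √(2 * Real.log (1 / δ))) / √N ≤ A * ε := fun A N hA hN => by
    have hN' : ((min m n : ℕ) : ℝ) ≤ N := by exact_mod_cast hN
    rw [hε, ← mul_div_assoc, ← mul_div_assoc]
    have := one_add_sqrt_two_mul_log_le hδ_pos hδ_le
    gcongr
  have hpi : Integrable p F := Integrable.of_bound hp.aestronglyMeasurable 1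
    (Filter.Eventually.of_forall fun x => abs_le.2 ⟨by linarith [hp0 x], hp1 x⟩)
  have hΛp : ∀ x, 0 ≤ Λ * p x ∧ Λ * p x ≤ Λ := fun x =>
    ⟨mul_nonneg hΛ0.le (hp0 x), mul_le_of_le_one_right hΛ0.le (hp1 x)⟩
  obtain ⟨S₁, hS₁, hP₁, h₁⟩ := exists_event_norm_weighted_featureMap_sub_le hk_meas hk_le F
    (a := fun _ => 1) measurable_const one_pos (by simp) (μ := μF) (by simpa using hμF) hn P X
    hX_meas hX_indep hX_law hδ_pos hδ1
  obtain ⟨S₂, hS₂, hP₂, h₂⟩ := exists_event_norm_weighted_featureMap_sub_le hk_meas hk_le H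
    (a := fun _ => 1) measurable_const one_pos (by simp) (μ := μH) (by simpa using hμH) hm P Y
    hY_meas hY_indep hY_law hδ_pos hδ1
  obtain ⟨S₃, hS₃, hP₃, h₃⟩ := exists_event_norm_weighted_featureMap_sub_le hk_meas hk_le F
    (a := fun x => Λ - Λ * p x) (measurable_const.sub (hp.const_mul Λ)) hΛ0
    (fun x => abs_le.2 ⟨by linarith [hΛp x], by linarith [hΛp x]⟩) (μ := (Λ - 1) • μH)
    (fun h => by rw [hpH, hμH, real_inner_smul_right]) hn P X hX_meas hX_indep hX_law hδ_pos hδ1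
  -- Centring `Λ * p` at `Λ / 2` halves the bound on the variable, and the halved error is what fits
  -- the budget `5 / 2 * Λ - 1`.
  obtain ⟨S₄, hS₄, hP₄, h₄⟩ := exists_event_norm_empirical_sub_le F (E := ℝ)
    (Z := fun x => Λ * p x - Λ / 2) (μ := 1 - Λ / 2) (A := Λ / 2) (by positivity)
    (fun x => abs_le.2 ⟨by linarith [hΛp x], by linarith [hΛp x]⟩)
    (fun v => ((hp.const_mul Λ).sub_const _).mul_const v)
    ((((hp.comp measurable_snd).const_mul Λ).sub_const _).mul
      (((hp.comp measurable_fst).const_mul Λ).sub_const _))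
    (fun v => by
      simp only [inner, RCLike.re_to_real]
      rw [integral_mul_const, integral_sub (hpi.const_mul Λ) (integrable_const _),
        integral_const_mul, hpΛ]
      simp) hn P X hX_meas hX_indep hX_law hδ_pos hδ1
  refine ⟨S₁ ∩ S₂ ∩ (S₃ ∩ S₄), (hS₁.inter hS₂).inter (hS₃.inter hS₄), ?_, ?_⟩
  · have hu : P.real (S₁ ∩ S₂ ∩ (S₃ ∩ S₄))ᶜ ≤ 4 * δ := by
      rw [Set.compl_inter, Set.compl_inter, Set.compl_inter]
      have := measureReal_union_le (μ := P) (S₁ᶜ ∪ S₂ᶜ) (S₃ᶜ ∪ S₄ᶜ)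
      have := measureReal_union_le (μ := P) S₁ᶜ S₂ᶜ
      have := measureReal_union_le (μ := P) S₃ᶜ S₄ᶜ
      linarith
    rw [probReal_compl_eq_one_sub ((hS₁.inter hS₂).inter (hS₃.inter hS₄))] at hu
    refine ENNReal.ofReal_le_of_le_toReal ?_
    change _ ≤ P.real _
    linarith
  · rintro ω ⟨⟨w₁, w₂⟩, w₃, w₄⟩
    refine ⟨?_, ?_, (h₃ ω w₃).trans (hrate _ _ hΛ0.le (min_le_right _ _)), ?_⟩
    · have := (h₁ ω w₁).trans (hrate _ _ zero_le_one (min_le_right _ _))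
      simpa [empiricalMean] using this
    · have := (h₂ ω w₂).trans (hrate _ _ zero_le_one (min_le_left _ _))
      simpa [empiricalMean] using this
    · have := (h₄ ω w₄).trans (hrate _ _ (by positivity) (min_le_right _ _))
      have hn' : (n : ℝ) ≠ 0 := by positivity
      have heq : (n : ℝ)⁻¹ • ∑ i, (Λ * p (X i ω) - Λ / 2) - (1 - Λ / 2)
          = (n : ℝ)⁻¹ * ∑ i, Λ * p (X i ω) - 1 := by
        rw [Finset.sum_sub_distrib, smul_eq_mul, mul_sub]
        simp
        field_simp
        ring
      rwa [heq, Real.norm_eq_abs] at this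

end MixtureProportion

/-! ### Assembly of the main theorem -/

theorem theorem3
    {𝒳 : Type*} [MetricSpace 𝒳] [CompactSpace 𝒳] [MeasurableSpace 𝒳] [BorelSpace 𝒳]
    -- a reproducing kernel Hilbert space with a measurable kernel `k` such that `k(x, x) ≤ 1`
    {𝓗 : Type*} [NormedAddCommGroup 𝓗] [InnerProductSpace ℝ 𝓗] [CompleteSpace 𝓗]
    [RKHS ℝ 𝓗 𝒳 ℝ]
    (hk_meas : Measurable (fun p : 𝒳 × 𝒳 => MixtureProportion.realKernel 𝓗 p.1 p.2))
    (hk_le : ∀ x : 𝒳, MixtureProportion.realKernel 𝓗 x x ≤ 1)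
    -- the distributions `G`, `H`, the mixture `F = (1 - κ) G + κ H` and `lam = 1 / (1 - κ)`
    (G H F : Measure 𝒳) [IsProbabilityMeasure G] [IsProbabilityMeasure H]
    (κ lam : ℝ) (hκ_nonneg : 0 ≤ κ) (hκ_lt : κ < 1)
    (hF : F = ENNReal.ofReal (1 - κ) • G + ENNReal.ofReal κ • H)
    (hlam : lam = 1 / (1 - κ))
    (α β : ℝ) (hsep : MixtureProportion.Separable 𝓗 G H α β)
    (δ : ℝ) (hδ_pos : 0 < δ) (hδ_le : δ ≤ 1 / 4)
    -- an i.i.d. sample of size `n` from `F` and an i.i.d. sample of size `m` from `H`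
    {Ω : Type*} [MeasurableSpace Ω] (P : Measure Ω) [IsProbabilityMeasure P]
    (n m : ℕ) (X : Fin n → Ω → 𝒳) (Y : Fin m → Ω → 𝒳)
    (hX_meas : ∀ i, Measurable (X i)) (hX_indep : iIndepFun X P) (hX_law : ∀ i, P.map (X i) = F)
    (hY_meas : ∀ j, Measurable (Y j)) (hY_indep : iIndepFun Y P) (hY_law : ∀ j, P.map (Y j) = H)
    (hmn : (12 * lam) ^ 2 * Real.log (1 / δ) / α ^ 2 < ((min m n : ℕ) : ℝ))
    (τ : ℝ)
    (hτ_lower : 3 * lam * √(Real.log (1 / δ)) * (2 - 1 / lam + √(2 / lam))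
      / √((min m n : ℕ) : ℝ) ≤ τ)
    (hτ_upper : τ ≤ 6 * lam * √(Real.log (1 / δ)) * (2 - 1 / lam + √(2 / lam))
      / √((min m n : ℕ) : ℝ)) :
    -- with probability at least `1 - 4 δ`
    ∃ E : Set Ω, MeasurableSet E ∧ ENNReal.ofReal (1 - 4 * δ) ≤ P E ∧ ∀ ω ∈ E,
      lam - MixtureProportion.valueThresholdEstimator 𝓗 (fun i => X i ω) (fun j => Y j ω) τ ≤ 0 ∧
      MixtureProportion.valueThresholdEstimator 𝓗 (fun i => X i ω) (fun j => Y j ω) τ - lam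
        ≤ β * lam / α
          + ((6 * α * lam ^ 2 * (2 - 1 / lam + √(2 / lam))
              + 2 * lam * (3 * α + 6 * lam * (2 + α + β))) / α ^ 2)
            * √(Real.log (1 / δ)) * ((min m n : ℕ) : ℝ) ^ (-(1 / 2) : ℝ) := by
  open MixtureProportion in
  have h1κ : 0 < 1 - κ := by linarith
  have hlam1 : 1 ≤ lam := by rw [hlam, le_div_iff₀ h1κ]; linarith
  have hlam0 : 0 < lam := by linarith
  have hlamκ : lam * (1 - κ) = 1 := by rw [hlam]; field_simp
  have hFprob : IsProbabilityMeasure F := by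
    constructor
    rw [hF]
    simp only [Measure.coe_add, Measure.coe_smul, Pi.add_apply, Pi.smul_apply, measure_univ,
      smul_eq_mul, mul_one]
    rw [← ENNReal.ofReal_add h1κ.le hκ_nonneg]
    simp
  obtain ⟨hα, h, hh, hGh, hHh⟩ := hsep
  have hintF : ∀ f : 𝒳 → ℝ, Integrable f G → Integrable f H →
      ∫ x, f x ∂F = (1 - κ) * ∫ x, f x ∂G + κ * ∫ x, f x ∂H := fun f hfG hfH => by
    rw [hF, integral_add_measure (hfG.smul_measure ENNReal.ofReal_ne_top)
      (hfH.smul_measure ENNReal.ofReal_ne_top), integral_smul_measure, integral_smul_measure,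
      ENNReal.toReal_ofReal h1κ.le, ENNReal.toReal_ofReal hκ_nonneg, smul_eq_mul, smul_eq_mul]
  have hcoeF := fun f : 𝓗 => hintF f (integrable_coe hk_meas hk_le G f)
    (integrable_coe hk_meas hk_le H f)
  have hfinG : IsFiniteMeasure (ENNReal.ofReal (1 - κ) • G) :=
    Measure.smul_finite G ENNReal.ofReal_ne_top
  obtain ⟨p, hp, hp0, hp1, hpint⟩ := exists_density_of_le (ENNReal.ofReal (1 - κ) • G) F
    (hF ▸ Measure.le_add_right le_rfl)
  have hpG : ∀ f : 𝒳 → ℝ, ∫ x, p x * f x ∂F = (1 - κ) * ∫ x, f x ∂G := fun f => by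
    rw [← hpint, integral_smul_measure, ENNReal.toReal_ofReal h1κ.le, smul_eq_mul]
  have hpΛ : lam * ∫ x, p x ∂F = 1 := by
    have := hpG fun _ => 1
    simp only [mul_one, integral_const, probReal_univ, smul_eq_mul] at this
    rw [this, hlamκ]
  obtain ⟨μF, hμF⟩ := exists_meanEmbedding hk_meas hk_le F
  obtain ⟨μH, hμH⟩ := exists_meanEmbedding hk_meas hk_le H
  -- `lam * p` is the density of `G`, so this is the identity `lam * F - G = (lam - 1) * H`.
  have hpH : ∀ f : 𝓗, ∫ x, (lam - lam * p x) * f x ∂F = (lam - 1) * ∫ x, f x ∂H := fun f => by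
    have hfi := integrable_coe hk_meas hk_le F f
    have hpfi : Integrable (fun x => p x * f x) F := hfi.bdd_mul (c := 1) hp.aestronglyMeasurable
      (Filter.Eventually.of_forall fun x => abs_le.2 ⟨by linarith [hp0 x], hp1 x⟩)
    have : ∀ x, (lam - lam * p x) * f x = lam * f x - lam * (p x * f x) := fun x => by ring
    simp only [this]
    rw [integral_sub (hfi.const_mul _) (hpfi.const_mul _), integral_const_mul, integral_const_mul,
      hpG, hcoeF]
    linear_combination (-(∫ x, f x ∂H)) * hlamκ
  set ℓ := Real.log (1 / δ) with hℓ
  have hℓ0 : 0 < ℓ := Real.log_pos (by rw [lt_div_iff₀ hδ_pos]; linarith)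
  have hmin0 : (0 : ℝ) < ((min m n : ℕ) : ℝ) := lt_of_le_of_lt (by positivity) hmn
  have hmin0' : 0 < min m n := by exact_mod_cast hmin0
  have hm : 0 < m := (lt_min_iff.1 hmin0').1
  have hn : 0 < n := (lt_min_iff.1 hmin0').2
  set M : ℝ := ((min m n : ℕ) : ℝ) with hM
  set u := 2 - 1 / lam + √(2 / lam) with hu
  have hu2 : 2 ≤ u := two_le_two_sub_inv_add_sqrt hlam1
  have hu5 : u ≤ 5 / 2 := two_sub_inv_add_sqrt_le hlam1
  set L := √ℓ / √M with hL
  have hL0 : 0 < L := by positivity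
  have hLα : 12 * lam * L < α := by
    -- The sample size condition is this inequality squared.
    refine lt_of_pow_lt_pow_left₀ 2 hα.le ?_
    rw [mul_pow, hL, div_pow, Real.sq_sqrt hℓ0.le, Real.sq_sqrt hmin0.le, ← mul_div_assoc,
      div_lt_iff₀ hmin0]
    rw [div_lt_iff₀ (by positivity)] at hmn
    linarith
  have hτl : 3 * lam * L * u ≤ τ := by
    refine le_trans (le_of_eq ?_) hτ_lower
    rw [hL]; ring
  have hτu : τ ≤ 6 * lam * L * u := by
    refine hτ_upper.trans (le_of_eq ?_)
    rw [hL]; ring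
  have hτ0 : 0 < τ := lt_of_lt_of_le (by positivity) hτl
  have habs : ∀ x, |h x| ≤ 1 := fun x => (abs_apply_le_norm hk_le h x).trans hh
  obtain ⟨x₀⟩ : Nonempty 𝒳 := nonempty_of_isProbabilityMeasure G
  have : Nonempty 𝒳 := ⟨x₀⟩
  have hbdd : BddBelow (Set.range (h : 𝒳 → ℝ)) :=
    ⟨-1, by rintro _ ⟨z, rfl⟩; exact (abs_le.1 (habs z)).1⟩
  have hinf : -1 ≤ ⨅ x, h x := le_ciInf fun x => (abs_le.1 (habs x)).1
  have hβ : 0 ≤ β := by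
    have : ∫ _x, (⨅ x, h x) ∂G ≤ ∫ x, h x ∂G :=
      integral_mono (integrable_const _) (integrable_coe hk_meas hk_le G h) fun x =>
        ciInf_le hbdd x
    rw [integral_const, probReal_univ, one_smul] at this
    linarith
  have hα2 : α ≤ 2 := by
    have : ∫ x, h x ∂H ≤ ∫ _x, 1 ∂H :=
      integral_mono (integrable_coe hk_meas hk_le H h) (integrable_const _) fun x =>
        (abs_le.1 (habs x)).2
    rw [integral_const, probReal_univ, one_smul] at this
    linarith
  have hLlam : lam / 2 * (12 / 5 * L) < 1 := by nlinarith
  obtain ⟨S, hS, hPS, hgood⟩ := exists_concentration_event hk_meas hk_le F H hp hp0 hp1 hlam1 hpΛ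
    hμF hμH hpH hδ_pos hδ_le P hn hm X Y hX_meas hX_indep hX_law hY_meas hY_indep hY_law
    (ε := 12 / 5 * L) rfl
  refine ⟨S, hS, hPS, fun ω hω => ?_⟩
  obtain ⟨w₁, w₂, w₃, w₄⟩ := hgood ω hω
  obtain ⟨w, hw, hwle⟩ := exists_mem_sampleHull_norm_sub_le (fun i => X i ω) (fun j => Y j ω)
    hk_le hn hlam1 (fun i => mul_nonneg hlam0.le (hp0 (X i ω))) w₂ w₃ w₄ hLlam
  have hwτ : ‖lam • empiricalMean 𝓗 (fun i => X i ω) + (1 - lam) • empiricalMean 𝓗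
      (fun j => Y j ω) - w‖ ≤ τ := by
    refine (hwle.trans ?_).trans hτl
    nlinarith [mul_pos hlam0 hL0]
  obtain ⟨l, hl, hlτ, hlle⟩ := exists_threshold_crossing hlam1 hα hα2 hβ hL0.le hLα hτ0.le hu5 hτu
  set T : Set ℝ :=
    {l : ℝ | 0 ≤ l ∧ τ ≤ empiricalDist 𝓗 (fun i => X i ω) (fun j => Y j ω) l} with hT
  have hlT : l ∈ T := by
    refine ⟨by linarith, hlτ.trans (le_trans ?_ (le_empiricalDist _ _ hk_le hn hh
      (hlam1.trans hl) w₁ w₂))⟩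
    rw [← hμF, ← hμH, hcoeF]
    set I := ⨅ x, h x
    set a := ∫ x, h x ∂G
    set b := ∫ x, h x ∂H
    have hκ' : 1 - κ = 1 / lam := by rw [hlam]; field_simp
    have hκ'' : κ = 1 - 1 / lam := by linarith
    have hr : 1 ≤ l / lam := by rwa [one_le_div hlam0]
    have e : I - l * ((1 - κ) * a + κ * b) - (1 - l) * b
        = I - l / lam * a + (l / lam - 1) * b := by
      rw [hκ', hκ'']; ring
    have e1 : l / lam * a ≤ l / lam * (I + β) := by gcongr
    have e2 : (l / lam - 1) * (I + β + α) ≤ (l / lam - 1) * b :=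
      mul_le_mul_of_nonneg_left (by linarith) (by linarith)
    linarith
  have hest : valueThresholdEstimator 𝓗 (fun i => X i ω) (fun j => Y j ω) τ = sInf T := rfl
  rw [hest]
  constructor
  -- The crossing point is needed here too: the infimum of an empty set would be `0`.
  · refine sub_nonpos.2 (le_csInf ⟨l, hlT⟩ fun l' hl' => ?_)
    by_contra! hlt
    exact absurd (empiricalDist_lt _ _ hn hm hτ0 hw hwτ hl'.1 hlt) (not_lt.2 hl'.2)
  · have hle : sInf T ≤ l := csInf_le ⟨0, fun _ h => h.1⟩ hlT
    have hrpow : √ℓ * M ^ (-(1 / 2) : ℝ) = L := by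
      rw [Real.rpow_neg hmin0.le, ← Real.sqrt_eq_rpow, hL, div_eq_mul_inv]
    rw [mul_assoc, hrpow]
    linarith
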